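/- For an integer $k\ge 0$ and $a=(a_1,\dots,a_n)\in\mathbb{R}^n$ let \[ h_k(a)=\sum_{1\le i_1\le\cdots\le i_k\le n}a_{i_1}\cdots a_{i_k} \] be the complete homogeneous symmetric polynomial of degree $k$. Let $n\ge 2$ and $k\ge 1$ be integers. (i) Suppose that $n$ is even. Then for all real numbers $a_1,\dots,a_n$ with $\sum_{i=1}^n a_i=0$ and $\sum_{i=1}^n a_i^2=1$, \[ h_{2k}(a_1,\dots,a_n)\ \ge\ \frac{\left(\frac n2+k-1\right)!}{k!\,\left(\frac n2-1\right)!\,n^k}, \] and equality is attained at the vector \[ \tilde a=\Big(\underbrace{\tfrac1{\sqrt n},\dots,\tfrac1{\sqrt n}}_{n/2},\underbrace{-\tfrac1{\sqrt n},\dots,-\tfrac1{\sqrt n}}_{n/2}\Big), \] which satisfies both constraints. (ii) For every $n\ge 2$, even or odd, the maximum of $h_{2k}$ over all $a\in\mathbb{R}^n$ with $\sum_{i=1}^n a_i=0$ and $\sum_{i=1}^n a_i^2=1$ is attained at the vector \[ \Big(\underbrace{-\tfrac{1}{\sqrt{n(n-1)}},\dots,-\tfrac{1}{\sqrt{n(n-1)}}}_{n-1},\sqrt{\tfrac{n-1}{n}}\Big),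 \] which satisfies both constraints. -/

import Mathlib

open scoped Nat

noncomputable section

/-- The complete homogeneous symmetric polynomial `h_k` evaluated at `a ∈ ℝⁿ`, that is,
the sum of `a_{i₁} ⋯ a_{i_k}` over `i₁ ≤ ⋯ ≤ i_k`. -/
def chs {n : ℕ} (k : ℕ) (a : Fin n → ℝ) : ℝ :=
  MvPolynomial.eval a (MvPolynomial.hsymm (Fin n) ℝ k)

/-- The centred unit sphere: vectors of `ℝⁿ` with `∑ aᵢ = 0` and `∑ aᵢ² = 1`. -/
def centredSphere (n : ℕ) : Set (Fin n → ℝ) :=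
  {a | ∑ i, a i = 0 ∧ ∑ i, a i ^ 2 = 1}

/-- The half-plus/half-minus vector (for even `n`): the first `n / 2` coordinates are `1 / √n`,
the other ones are `-1 / √n`. -/
def halfVector (n : ℕ) : Fin n → ℝ :=
  fun i => if (i : ℕ) < n / 2 then 1 / √(n : ℝ) else -(1 / √(n : ℝ))

/-- The vector whose first `n - 1` coordinates are `-1 / √(n (n - 1))` and whose last coordinate
is `√((n - 1) / n)`. -/
def spikeVector (n : ℕ) : Fin n → ℝ :=
  fun i => if (i : ℕ) + 1 = n then √(((n : ℝ) - 1) / n) else -(1 / √((n : ℝ) * ((n : ℝ) - 1)))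

end

/-!
The generating series `∑ h_k(s) Xᵏ = ∏ (1 - a X)⁻¹`, over the elements `a` of a multiset `s`, turns
the problem into a variation of three elements. If `x, y, z` are replaced by `x', y', z'` with the
same sum and the same sum of squares, the series changes by
`(x' y' z' - x y z) X³ ∏ (1 - a X)⁻¹`, where the product runs over all elements of `s` and over
`x', y', z'` (`chsSeries_triple_sub`). Since the `h_{2m}` are nonnegative
(`coeff_even_chsSeries_nonneg`), `h_{2k}` is a convex function of the product `x y z`, and the first
variation `D(x, y, z)`, the coefficient at `X ^ (2 k)` of `X³ ∏ (1 - a X)⁻¹` over `s` together with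
second copies of `x, y, z`, is monotone in each of `x, y, z`. Adding `ε (h₄ + h₆)` makes these
properties strict; at the end `ε` tends to `0`. For `x ≤ y < z` the product can be decreased, for
`x < y ≤ z` it can be increased (`exists_deformation` and its mirror image).

At a maximizer, therefore, `D(x, y, z) > 0` if `x ≤ y < z` and `D(x, y, z) < 0` if `x < y ≤ z`.
Hence no three elements are distinct, and two values `q < p` cannot both occur twice, because
`D(q, q, p) > 0 > D(q, p, p)` contradicts monotonicity. So all elements but one are equal
(`eq_cons_replicate_of_isMaxOn`), and the constraints leave only the spike vector and its negative.

At a minimizer, the weak opposite inequalities hold. With `q` the smallest and `p` the largest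
element, two elements `r ≤ y` strictly between them would give
`0 ≤ D(q, r, p) < D(r, y, p) ≤ 0`. So all elements but one are `p` or `q`
(`exists_eq_cons_of_isMinOn`). For such a multiset with sum zero, all power sums of odd degree have
the same sign (`sum_odd_pow_sign`), and by negation it may be assumed nonnegative. In Newton's
identities `m h_m = ∑ p_j h_{m-j}` the terms with odd `j` may then be dropped, and the power mean
inequality `p_{2i} ≥ n ^ (1 - i)` bounds `h_{2k}` below by the coefficients of
`(1 - X² / n) ^ (-n / 2)` (`balancedCoeff_le_of_sum_odd_pow_nonneg`). For the vector with entries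
`±1 / √n` of sum zero all these inequalities are equalities.
-/

/-! ### The generating series of the complete homogeneous symmetric polynomials -/

/-- The geometric series `∑ aʲ Xʲ`, the inverse of `1 - a X`. -/
noncomputable def geomSeries (a : ℝ) : PowerSeries ℝ := PowerSeries.mk fun j => a ^ j

/-- The generating series `∏ (1 - a X)⁻¹`, over the elements `a` of a multiset, whose coefficient
at `Xᵏ` is the complete homogeneous symmetric polynomial `h_k` of that multiset. -/
noncomputable def chsSeries (s : Multiset ℝ) : PowerSeries ℝ := (s.map geomSeries).prod

open PowerSeries in
theorem one_sub_mul_geomSeries (a : ℝ) : (1 - C a * X) * geomSeries a = 1 := by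
  ext n
  rcases n with _ | n
  · simp [geomSeries]
  · rw [sub_mul, one_mul, map_sub, mul_assoc, coeff_C_mul, coeff_succ_X_mul]
    simp [geomSeries, pow_succ', coeff_one]

@[simp] theorem coeff_geomSeries (a : ℝ) (j : ℕ) : PowerSeries.coeff j (geomSeries a) = a ^ j := by
  simp [geomSeries]

@[simp] theorem chsSeries_zero : chsSeries 0 = 1 := by simp [chsSeries]

@[simp] theorem chsSeries_cons (a : ℝ) (s : Multiset ℝ) :
    chsSeries (a ::ₘ s) = geomSeries a * chsSeries s := by simp [chsSeries]

theorem chs_eq_coeff_chsSeries {n : ℕ} (k : ℕ) (a : Fin n → ℝ) :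
    chs k a = PowerSeries.coeff k (chsSeries (Finset.univ.val.map a)) := by
  have h1 : chsSeries (Finset.univ.val.map a) = ∏ i, geomSeries (a i) := by
    rw [chsSeries, Multiset.map_map]
    rfl
  rw [h1, PowerSeries.coeff_prod, chs, MvPolynomial.hsymm, map_sum]
  refine Finset.sum_bij (fun (s : Sym (Fin n) k) _ => Multiset.toFinsupp s.1) ?_ ?_ ?_ ?_
  · intro s _
    rw [Finset.mem_finsuppAntidiag]
    refine ⟨?_, Finset.subset_univ _⟩
    exact (Multiset.sum_count_eq_card fun i _ => Finset.mem_univ i).trans s.2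
  · intro s _ t _ h
    exact Subtype.ext (Multiset.toFinsupp.injective h)
  · intro f hf
    rw [Finset.mem_finsuppAntidiag] at hf
    refine ⟨⟨Finsupp.toMultiset f, ?_⟩, Finset.mem_univ _, by simp⟩
    rw [Finsupp.card_toMultiset, Finsupp.sum_fintype _ _ (fun _ => rfl)]
    simpa using hf.1
  · intro s _
    rw [map_multiset_prod, Multiset.map_map, Finset.prod_multiset_map_count]
    simp only [Function.comp_apply, MvPolynomial.eval_X, coeff_geomSeries,
      Multiset.toFinsupp_apply]
    refine Finset.prod_subset (Finset.subset_univ _) fun i _ hi => ?_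
    rw [Multiset.count_eq_zero_of_notMem (by simpa using hi), pow_zero]

@[simp] theorem coeff_zero_chsSeries (s : Multiset ℝ) : PowerSeries.coeff 0 (chsSeries s) = 1 := by
  induction s using Multiset.induction_on with
  | empty => simp
  | cons a s ih =>
    simp only [PowerSeries.coeff_zero_eq_constantCoeff] at ih ⊢
    rw [chsSeries_cons, map_mul, ih, ← PowerSeries.coeff_zero_eq_constantCoeff_apply]
    simp

theorem coeff_chsSeries_neg (s : Multiset ℝ) (k : ℕ) :
    PowerSeries.coeff k (chsSeries (s.map (-·))) =
      (-1) ^ k * PowerSeries.coeff k (chsSeries s) := by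
  induction s using Multiset.induction_on generalizing k with
  | empty => rcases k with _ | k <;> simp [PowerSeries.coeff_one]
  | cons a s ih =>
    rw [Multiset.map_cons, chsSeries_cons, chsSeries_cons, PowerSeries.coeff_mul,
      PowerSeries.coeff_mul, Finset.mul_sum]
    refine Finset.sum_congr rfl fun ij h => ?_
    rw [ih, coeff_geomSeries, coeff_geomSeries, neg_pow,
      ← Finset.HasAntidiagonal.mem_antidiagonal.1 h, pow_add]
    ring

theorem coeff_chsSeries_nonneg {s : Multiset ℝ} (hs : ∀ a ∈ s, 0 ≤ a) (k : ℕ) :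
    0 ≤ PowerSeries.coeff k (chsSeries s) := by
  induction s using Multiset.induction_on generalizing k with
  | empty => rcases k with _ | k <;> simp [PowerSeries.coeff_one]
  | cons a s ih =>
    rw [chsSeries_cons, PowerSeries.coeff_mul]
    refine Finset.sum_nonneg fun ij _ => mul_nonneg ?_ (ih (fun b hb => hs b (by simp [hb])) _)
    simpa using pow_nonneg (hs a (by simp)) _

open PowerSeries in
theorem chsSeries_pair_sub {x y x' y' : ℝ} (s : Multiset ℝ) (h1 : x' + y' = x + y) :
    chsSeries (x' ::ₘ y' ::ₘ s) - chsSeries (x ::ₘ y ::ₘ s) =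
      C (x * y - x' * y') * (X ^ 2 * chsSeries (x' ::ₘ y' ::ₘ x ::ₘ y ::ₘ s)) := by
  have e1 : (C x' : PowerSeries ℝ) + C y' = C x + C y := by simp only [← map_add, h1]
  simp only [chsSeries_cons, map_sub, map_mul]
  have hx := one_sub_mul_geomSeries x
  have hy := one_sub_mul_geomSeries y
  have hx' := one_sub_mul_geomSeries x'
  have hy' := one_sub_mul_geomSeries y'
  generalize geomSeries x = gx at *
  generalize geomSeries y = gy at *
  generalize geomSeries x' = gx' at *
  generalize geomSeries y' = gy' at *
  have hp : ((1 - C x * X) * gx) * ((1 - C y * X) * gy) = 1 := by rw [hx, hy, one_mul]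
  have hp' : ((1 - C x' * X) * gx') * ((1 - C y' * X) * gy') = 1 := by rw [hx', hy', one_mul]
  linear_combination (-(chsSeries s * gx' * gy')) * hp + (chsSeries s * gx * gy) * hp' +
    (chsSeries s * gx * gy * gx' * gy' * X) * e1

/-- Replacing three elements by three others with the same first two elementary symmetric
functions changes the generating series by a multiple of a generating series of the same kind;
the factor is the change of the product of the three elements. -/
theorem chsSeries_triple_sub {x y z x' y' z' : ℝ} (s : Multiset ℝ) (h1 : x' + y' + z' = x + y + z)
    (h2 : x' * y' + y' * z' + z' * x' = x * y + y * z + z * x) :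
    chsSeries (x' ::ₘ y' ::ₘ z' ::ₘ s) - chsSeries (x ::ₘ y ::ₘ z ::ₘ s) =
      PowerSeries.C (x' * y' * z' - x * y * z) * (PowerSeries.X ^ 3 *
        chsSeries (x' ::ₘ y' ::ₘ z' ::ₘ x ::ₘ y ::ₘ z ::ₘ s)) := by
  open PowerSeries in
  have e1 : (C x' : PowerSeries ℝ) + C y' + C z' = C x + C y + C z := by simp only [← map_add, h1]
  have e2 : (C x' : PowerSeries ℝ) * C y' + C y' * C z' + C z' * C x' =
      C x * C y + C y * C z + C z * C x := by simp only [← map_add, ← map_mul, h2]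
  simp only [chsSeries_cons, map_sub, map_mul]
  have hx := one_sub_mul_geomSeries x
  have hy := one_sub_mul_geomSeries y
  have hz := one_sub_mul_geomSeries z
  have hx' := one_sub_mul_geomSeries x'
  have hy' := one_sub_mul_geomSeries y'
  have hz' := one_sub_mul_geomSeries z'
  generalize geomSeries x = gx at *
  generalize geomSeries y = gy at *
  generalize geomSeries z = gz at *
  generalize geomSeries x' = gx' at *
  generalize geomSeries y' = gy' at *
  generalize geomSeries z' = gz' at *
  have hp : ((1 - C x * X) * gx) * ((1 - C y * X) * gy) * ((1 - C z * X) * gz) = 1 := by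
    rw [hx, hy, hz, one_mul, one_mul]
  have hp' : ((1 - C x' * X) * gx') * ((1 - C y' * X) * gy') * ((1 - C z' * X) * gz') = 1 := by
    rw [hx', hy', hz', one_mul, one_mul]
  linear_combination (-(chsSeries s * gx' * gy' * gz')) * hp + (chsSeries s * gx * gy * gz) * hp' +
    (chsSeries s * gx * gy * gz * gx' * gy' * gz') * (X * e1 - X ^ 2 * e2)

open PowerSeries in
theorem chsSeries_single_sub (x x' : ℝ) (s : Multiset ℝ) :
    chsSeries (x' ::ₘ s) - chsSeries (x ::ₘ s) =
      C (x' - x) * (X * chsSeries (x' ::ₘ x ::ₘ s)) := by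
  simp only [chsSeries_cons, map_sub]
  linear_combination (-(chsSeries s * geomSeries x')) * one_sub_mul_geomSeries x +
    (chsSeries s * geomSeries x) * one_sub_mul_geomSeries x'

/-- The complete homogeneous symmetric polynomials of even degree are nonnegative. Two elements
`x`, `y` of opposite signs can be merged into `x + y`, which lowers the value by a nonnegative
multiple of the polynomial of degree two less; elements of one sign are harmless. -/
theorem coeff_even_chsSeries_nonneg (m : ℕ) (s : Multiset ℝ) :
    0 ≤ PowerSeries.coeff (2 * m) (chsSeries s) := by
  induction m generalizing s with
  | zero => simp
  | succ m ihm =>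
    induction hc : s.card using Nat.strong_induction_on generalizing s with
    | _ c ihc =>
      by_cases hpos : ∀ a ∈ s, 0 ≤ a
      · exact coeff_chsSeries_nonneg hpos _
      by_cases hneg : ∀ a ∈ s, a ≤ 0
      · have h := coeff_chsSeries_nonneg (s := s.map (-·)) (by simpa using hneg) (2 * (m + 1))
        rwa [coeff_chsSeries_neg, (even_two_mul _).neg_one_pow, one_mul] at h
      push Not at hpos hneg
      obtain ⟨x, hx, hx0⟩ := hpos
      obtain ⟨y, hy, hy0⟩ := hneg
      obtain ⟨t, rfl⟩ := Multiset.exists_cons_of_mem hx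
      have hyt : y ∈ t := by
        rcases Multiset.mem_cons.1 hy with rfl | h
        · linarith
        · exact h
      obtain ⟨t, rfl⟩ := Multiset.exists_cons_of_mem hyt
      have h := congrArg (PowerSeries.coeff (2 * (m + 1)))
        (chsSeries_pair_sub (x' := x + y) (y' := 0) t (add_zero (x + y)))
      have h0 : geomSeries 0 = 1 := by
        ext j; rcases j with _ | j <;> simp [PowerSeries.coeff_one]
      have hx2 := ihc _ (by simp [← hc]) ((x + y) ::ₘ t) rfl
      have hh := ihm ((x + y) ::ₘ 0 ::ₘ x ::ₘ y ::ₘ t)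
      rw [map_sub, PowerSeries.coeff_C_mul, show 2 * (m + 1) = 2 * m + 2 by ring,
        PowerSeries.coeff_X_pow_mul] at h
      rw [show 2 * (m + 1) = 2 * m + 2 by ring] at hx2 ⊢
      rw [chsSeries_cons (x + y) (0 ::ₘ t), chsSeries_cons 0 t, h0, one_mul,
        ← chsSeries_cons] at h
      nlinarith [mul_pos_of_neg_of_neg hx0 (neg_neg_of_pos hy0)]

/-! ### A strictly convex perturbation of the functional -/

/-- The functional `h_{2k} + ε (h₄ + h₆)`, read off from a generating series. For `ε > 0` it is
strictly convex along the deformations of three elements that fix their sum and sum of squares,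
which `h_{2k}` alone is not for small `k`. -/
noncomputable def perturbedCoeff (k : ℕ) (ε : ℝ) : PowerSeries ℝ →ₗ[ℝ] ℝ :=
  PowerSeries.coeff (2 * k) + ε • (PowerSeries.coeff 4 + PowerSeries.coeff 6)

theorem perturbedCoeff_apply (k : ℕ) (ε : ℝ) (f : PowerSeries ℝ) :
    perturbedCoeff k ε f = PowerSeries.coeff (2 * k) f +
      ε * (PowerSeries.coeff 4 f + PowerSeries.coeff 6 f) := rfl

theorem perturbedCoeff_C_mul (k : ℕ) (ε c : ℝ) (f : PowerSeries ℝ) :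
    perturbedCoeff k ε (PowerSeries.C c * f) = c * perturbedCoeff k ε f := by
  rw [← PowerSeries.smul_eq_C_mul, map_smul, smul_eq_mul]

theorem coeff_X_pow_mul_chsSeries_nonneg (m i : ℕ) (s : Multiset ℝ) :
    0 ≤ PowerSeries.coeff (2 * m) (PowerSeries.X ^ (2 * i) * chsSeries s) := by
  rw [PowerSeries.coeff_X_pow_mul']
  split_ifs
  · rw [← Nat.mul_sub]
    exact coeff_even_chsSeries_nonneg _ s
  · rfl

theorem perturbedCoeff_X_pow_four_pos (k : ℕ) {ε : ℝ} (hε : 0 < ε) (s : Multiset ℝ) :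
    0 < perturbedCoeff k ε (PowerSeries.X ^ 4 * chsSeries s) := by
  have h1 := coeff_X_pow_mul_chsSeries_nonneg k 2 s
  have h2 := coeff_X_pow_mul_chsSeries_nonneg 3 2 s
  have h3 : PowerSeries.coeff 4 (PowerSeries.X ^ 4 * chsSeries s) = 1 := by
    rw [PowerSeries.coeff_X_pow_mul', if_pos le_rfl]; simp
  rw [perturbedCoeff_apply, h3]
  norm_num at h1 h2
  positivity

theorem perturbedCoeff_X_pow_six_pos (k : ℕ) {ε : ℝ} (hε : 0 < ε) (s : Multiset ℝ) :
    0 < perturbedCoeff k ε (PowerSeries.X ^ 6 * chsSeries s) := by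
  have h1 := coeff_X_pow_mul_chsSeries_nonneg k 3 s
  have h2 := coeff_X_pow_mul_chsSeries_nonneg 2 3 s
  have h3 : PowerSeries.coeff 6 (PowerSeries.X ^ 6 * chsSeries s) = 1 := by
    rw [PowerSeries.coeff_X_pow_mul', if_pos le_rfl]; simp
  rw [perturbedCoeff_apply, h3]
  norm_num at h1 h2
  positivity

theorem perturbedCoeff_X_pow_mul_neg (k : ℕ) (ε : ℝ) (j : ℕ) (s : Multiset ℝ) :
    perturbedCoeff k ε (PowerSeries.X ^ j * chsSeries (s.map (-·))) =
      (-1) ^ j * perturbedCoeff k ε (PowerSeries.X ^ j * chsSeries s) := by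
  have key : ∀ m, PowerSeries.coeff (2 * m) (PowerSeries.X ^ j * chsSeries (s.map (-·))) =
      (-1) ^ j * PowerSeries.coeff (2 * m) (PowerSeries.X ^ j * chsSeries s) := by
    intro m
    rw [PowerSeries.coeff_X_pow_mul', PowerSeries.coeff_X_pow_mul']
    split_ifs with h
    · rw [coeff_chsSeries_neg]
      congr 1
      have h2 : (-1 : ℝ) ^ j * (-1) ^ (2 * m - j) = 1 := by
        rw [← pow_add, Nat.add_sub_cancel' h, (even_two_mul m).neg_one_pow]
      have h3 : (-1 : ℝ) ^ j * (-1) ^ j = 1 := by rw [← mul_pow]; norm_num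
      linear_combination (-1 : ℝ) ^ j * h2 - (-1 : ℝ) ^ (2 * m - j) * h3
    · simp
  simp only [perturbedCoeff_apply]
  rw [key k, key 2, key 3]
  ring

theorem perturbedCoeff_neg (k : ℕ) (ε : ℝ) (s : Multiset ℝ) :
    perturbedCoeff k ε (chsSeries (s.map (-·))) = perturbedCoeff k ε (chsSeries s) := by
  simpa using perturbedCoeff_X_pow_mul_neg k ε 0 s

/-- The first variation at `s`, when the product of `x`, `y`, `z` varies, is strictly increasing
in each of `x`, `y`, `z`. -/
theorem perturbedCoeff_X_pow_three_lt (k : ℕ) {ε : ℝ} (hε : 0 < ε) {x x' : ℝ} (h : x < x')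
    (s : Multiset ℝ) :
    perturbedCoeff k ε (PowerSeries.X ^ 3 * chsSeries (x ::ₘ s)) <
      perturbedCoeff k ε (PowerSeries.X ^ 3 * chsSeries (x' ::ₘ s)) := by
  have h1 : PowerSeries.X ^ 3 * chsSeries (x' ::ₘ s) - PowerSeries.X ^ 3 * chsSeries (x ::ₘ s) =
      PowerSeries.C (x' - x) * (PowerSeries.X ^ 4 * chsSeries (x' ::ₘ x ::ₘ s)) := by
    rw [← mul_sub, chsSeries_single_sub]; ring
  have h2 := congrArg (perturbedCoeff k ε) h1
  rw [map_sub, perturbedCoeff_C_mul] at h2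
  have h3 := mul_pos (sub_pos.2 h) (perturbedCoeff_X_pow_four_pos k hε (x' ::ₘ x ::ₘ s))
  linarith

/-! ### Variations of three elements -/

/-- Multisets of `n` real numbers with sum `0` and sum of squares `1`. -/
def centredMultisets (n : ℕ) : Set (Multiset ℝ) :=
  {s | s.card = n ∧ s.sum = 0 ∧ (s.map (· ^ 2)).sum = 1}

theorem neg_mem_centredMultisets {n : ℕ} {s : Multiset ℝ} (hs : s ∈ centredMultisets n) :
    s.map (-·) ∈ centredMultisets n := by
  obtain ⟨h1, h2, h3⟩ := hs
  refine ⟨by simpa using h1, by simp [Multiset.sum_map_neg', h2], ?_⟩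
  simpa [Multiset.map_map] using h3

theorem replace_mem_centredMultisets {n : ℕ} {t : Multiset ℝ} {x y z x' y' z' : ℝ}
    (hs : x ::ₘ y ::ₘ z ::ₘ t ∈ centredMultisets n) (h1 : x' + y' + z' = x + y + z)
    (h2 : x' * y' + y' * z' + z' * x' = x * y + y * z + z * x) :
    x' ::ₘ y' ::ₘ z' ::ₘ t ∈ centredMultisets n := by
  obtain ⟨hc, hsum, hsq⟩ := hs
  simp only [Multiset.card_cons, Multiset.sum_cons, Multiset.map_cons] at hc hsum hsq
  refine ⟨by simpa using hc, ?_, ?_⟩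
  · simp only [Multiset.sum_cons]
    linarith
  · simp only [Multiset.map_cons, Multiset.sum_cons]
    linear_combination hsq - 2 * h2 + (x' + y' + z' + x + y + z) * h1

/-- Three reals `x`, `y`, `z` with `x ≤ y < z` can be deformed continuously so that their sum and
their sum of squares stay fixed and their product decreases: `z` becomes `z - δ`, and the other two
are the roots of the quadratic polynomial this dictates. -/
theorem exists_deformation {x y z : ℝ} (hxy : x ≤ y) :
    ∃ u v : ℝ → ℝ, Continuous u ∧ Continuous v ∧ u 0 = x ∧ v 0 = y ∧
      ∀ δ ∈ Set.Ioo 0 (z - y), u δ + v δ + (z - δ) = x + y + z ∧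
        u δ * v δ + v δ * (z - δ) + (z - δ) * u δ = x * y + y * z + z * x ∧
        u δ * v δ * (z - δ) < x * y * z := by
  have h0 : √((y - x) ^ 2 + 0 * (2 * (z - x) + 2 * (z - y) - 3 * 0)) = y - x := by
    rw [zero_mul, add_zero, Real.sqrt_sq (by linarith)]
  refine ⟨fun δ => (x + y + δ - √((y - x) ^ 2 + δ * (2 * (z - x) + 2 * (z - y) - 3 * δ))) / 2,
    fun δ => (x + y + δ + √((y - x) ^ 2 + δ * (2 * (z - x) + 2 * (z - y) - 3 * δ))) / 2,
    by fun_prop, by fun_prop, ?_, ?_, ?_⟩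
  · simp only [h0]; ring
  · simp only [h0]; ring
  · rintro δ ⟨hδ0, hδ⟩
    have hd : 0 ≤ (y - x) ^ 2 + δ * (2 * (z - x) + 2 * (z - y) - 3 * δ) :=
      add_nonneg (sq_nonneg _) (mul_nonneg hδ0.le (by linarith))
    have hr := Real.mul_self_sqrt hd
    set r := √((y - x) ^ 2 + δ * (2 * (z - x) + 2 * (z - y) - 3 * δ))
    refine ⟨by ring, by linear_combination (-1 / 4) * hr, ?_⟩
    have hneg : 0 < δ * ((z - δ - x) * (z - δ - y)) :=
      mul_pos hδ0 (mul_pos (by linarith) (by linarith))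
    have : (x + y + δ - r) / 2 * ((x + y + δ + r) / 2) * (z - δ) - x * y * z =
        -(δ * ((z - δ - x) * (z - δ - y))) := by
      linear_combination (-(z - δ) / 4) * hr
    linarith

theorem perturbedCoeff_triple_sub (k : ℕ) (ε : ℝ) {x y z x' y' z' : ℝ} (t : Multiset ℝ)
    (h1 : x' + y' + z' = x + y + z)
    (h2 : x' * y' + y' * z' + z' * x' = x * y + y * z + z * x) :
    perturbedCoeff k ε (chsSeries (x' ::ₘ y' ::ₘ z' ::ₘ t)) -
        perturbedCoeff k ε (chsSeries (x ::ₘ y ::ₘ z ::ₘ t)) =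
      (x' * y' * z' - x * y * z) * perturbedCoeff k ε (PowerSeries.X ^ 3 *
        chsSeries (x' ::ₘ y' ::ₘ z' ::ₘ x ::ₘ y ::ₘ z ::ₘ t)) := by
  rw [← map_sub, chsSeries_triple_sub t h1 h2, perturbedCoeff_C_mul]

theorem exists_min_max_of_mem_centredMultisets {n : ℕ} {s : Multiset ℝ}
    (hs : s ∈ centredMultisets n) :
    ∃ q p t, s = q ::ₘ p ::ₘ t ∧ q < p ∧ ∀ y ∈ s, q ≤ y ∧ y ≤ p := by
  obtain ⟨-, hsum, hsq⟩ := hs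
  have hne : s.toFinset.Nonempty := by
    rw [Multiset.toFinset_nonempty]
    rintro rfl
    simp at hsq
  obtain ⟨q, hq, hqmin⟩ := s.toFinset.exists_min_image id hne
  obtain ⟨p, hp, hpmax⟩ := s.toFinset.exists_max_image id hne
  simp only [Multiset.mem_toFinset, id] at hq hqmin hp hpmax
  have hqp : q < p := by
    refine lt_of_le_of_ne (hqmin p hp) fun h => ?_
    have hall : s = Multiset.replicate s.card q :=
      Multiset.eq_replicate_card.2 fun y hy => le_antisymm (h ▸ hpmax y hy) (hqmin y hy)
    rw [hall] at hsum hsq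
    simp only [Multiset.sum_replicate, Multiset.map_replicate, nsmul_eq_mul] at hsum hsq
    rw [pow_two, ← mul_assoc, hsum, zero_mul] at hsq
    exact zero_ne_one hsq
  obtain ⟨t, rfl⟩ := Multiset.exists_cons_of_mem hq
  obtain ⟨t, rfl⟩ := Multiset.exists_cons_of_mem
    ((Multiset.mem_cons.1 hp).resolve_left hqp.ne')
  exact ⟨q, p, t, rfl, hqp, fun y hy => ⟨hqmin y hy, hpmax y hy⟩⟩

section Maximizer

variable {n k : ℕ} {ε : ℝ} {s t : Multiset ℝ} {x y z : ℝ}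

/-- At a maximizer, the first variation is positive for every triple whose product can be
decreased. Strictness comes from strict convexity. -/
theorem first_variation_pos_of_isMaxOn (hε : 0 < ε) (hs : s ∈ centredMultisets n)
    (hmax : IsMaxOn (fun s => perturbedCoeff k ε (chsSeries s)) (centredMultisets n) s)
    (hst : s = x ::ₘ y ::ₘ z ::ₘ t) (hxy : x ≤ y) (hyz : y < z) :
    0 < perturbedCoeff k ε (PowerSeries.X ^ 3 * chsSeries (x ::ₘ y ::ₘ z ::ₘ s)) := by
  subst hst
  obtain ⟨u, v, -, -, -, -, h⟩ := exists_deformation (z := z) hxy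
  obtain ⟨h1, h2, h3⟩ := h ((z - y) / 2) ⟨by linarith, by linarith⟩
  generalize u ((z - y) / 2) = x' at *
  generalize v ((z - y) / 2) = y' at *
  generalize z - (z - y) / 2 = z' at *
  have hle : perturbedCoeff k ε (chsSeries (x' ::ₘ y' ::ₘ z' ::ₘ t)) ≤
    perturbedCoeff k ε (chsSeries (x ::ₘ y ::ₘ z ::ₘ t)) :=
    hmax (replace_mem_centredMultisets hs h1 h2)
  have e1 := perturbedCoeff_triple_sub k ε t h1 h2
  have e2 : perturbedCoeff k ε (PowerSeries.X ^ 3 *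
        chsSeries (x' ::ₘ y' ::ₘ z' ::ₘ x ::ₘ y ::ₘ z ::ₘ t)) -
      perturbedCoeff k ε (PowerSeries.X ^ 3 *
        chsSeries (x ::ₘ y ::ₘ z ::ₘ x ::ₘ y ::ₘ z ::ₘ t)) =
      (x' * y' * z' - x * y * z) * perturbedCoeff k ε (PowerSeries.X ^ 6 *
        chsSeries (x' ::ₘ y' ::ₘ z' ::ₘ x ::ₘ y ::ₘ z ::ₘ x ::ₘ y ::ₘ z ::ₘ t)) := by
    rw [← map_sub, ← mul_sub, chsSeries_triple_sub _ h1 h2, mul_left_comm, perturbedCoeff_C_mul,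
      ← mul_assoc, ← pow_add]
  have hpos := perturbedCoeff_X_pow_six_pos k hε
    (x' ::ₘ y' ::ₘ z' ::ₘ x ::ₘ y ::ₘ z ::ₘ x ::ₘ y ::ₘ z ::ₘ t)
  have h3' := sub_neg.2 h3
  have e3 := mul_neg_of_neg_of_pos h3' hpos
  have e4 := nonneg_of_mul_nonpos_right (e1.symm.trans_le (sub_nonpos.2 hle)) h3'
  linarith

theorem first_variation_neg_of_isMaxOn (hε : 0 < ε) (hs : s ∈ centredMultisets n)
    (hmax : IsMaxOn (fun s => perturbedCoeff k ε (chsSeries s)) (centredMultisets n) s)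
    (hst : s = x ::ₘ y ::ₘ z ::ₘ t) (hxy : x < y) (hyz : y ≤ z) :
    perturbedCoeff k ε (PowerSeries.X ^ 3 * chsSeries (x ::ₘ y ::ₘ z ::ₘ s)) < 0 := by
  have h := first_variation_pos_of_isMaxOn (k := k) (s := s.map (-·)) (t := t.map (-·)) (x := -z)
    (y := -y) (z := -x) hε (neg_mem_centredMultisets hs)
    (fun r hr => by simpa only [Set.mem_ofPred_eq, perturbedCoeff_neg] using hmax hr)
    (by subst hst; simp [Multiset.cons_swap]) (by linarith) (by linarith)
  have e : (-z) ::ₘ (-y) ::ₘ (-x) ::ₘ s.map (-·) = (x ::ₘ y ::ₘ z ::ₘ s).map (-·) := by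
    simp [Multiset.cons_swap]
  rw [e, perturbedCoeff_X_pow_mul_neg] at h
  linarith

/-- A maximizer has all but one of its elements equal. -/
theorem eq_cons_replicate_of_isMaxOn (hε : 0 < ε) (hs : s ∈ centredMultisets n)
    (hmax : IsMaxOn (fun s => perturbedCoeff k ε (chsSeries s)) (centredMultisets n) s) :
    ∃ p q, s = p ::ₘ Multiset.replicate (n - 1) q := by
  obtain ⟨q, p, t, hst, hqp, hbd⟩ := exists_min_max_of_mem_centredMultisets hs
  have hcard : n - 1 = t.card + 1 := by rw [← hs.1, hst]; simp
  have hval : ∀ y ∈ t, y = q ∨ y = p := by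
    intro y hy
    by_contra! hne
    obtain ⟨hqy, hyp⟩ := hbd y (by simp [hst, hy])
    have hqy' := lt_of_le_of_ne hqy hne.1.symm
    have hyp' := lt_of_le_of_ne hyp hne.2
    obtain ⟨t, rfl⟩ := Multiset.exists_cons_of_mem hy
    rw [Multiset.cons_swap p y] at hst
    have h1 := first_variation_pos_of_isMaxOn hε hs hmax hst hqy hyp'
    have h2 := first_variation_neg_of_isMaxOn hε hs hmax hst hqy' hyp
    linarith
  by_cases hqt : q ∈ t
  · by_cases hpt : p ∈ t
    · obtain ⟨t, rfl⟩ := Multiset.exists_cons_of_mem hqt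
      obtain ⟨t, rfl⟩ := Multiset.exists_cons_of_mem
        ((Multiset.mem_cons.1 hpt).resolve_left hqp.ne')
      have h1 := first_variation_pos_of_isMaxOn (x := q) (y := q) (z := p) (t := p ::ₘ t) hε hs
        hmax (by rw [hst, Multiset.cons_swap p q]) le_rfl hqp
      have h2 := first_variation_neg_of_isMaxOn (x := q) (y := p) (z := p) (t := q ::ₘ t) hε hs
        hmax (by rw [hst, Multiset.cons_swap q p t]) hqp le_rfl
      have h3 := perturbedCoeff_X_pow_three_lt k hε hqp (q ::ₘ p ::ₘ s)
      rw [Multiset.cons_swap p q] at h3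
      linarith
    · refine ⟨p, q, ?_⟩
      rw [hst, Multiset.cons_swap, hcard, Multiset.replicate_succ,
        ← Multiset.eq_replicate_card.2 fun y hy =>
          (hval y hy).resolve_right fun h => hpt (h ▸ hy)]
  · refine ⟨q, p, ?_⟩
    rw [hst, hcard, Multiset.replicate_succ,
      ← Multiset.eq_replicate_card.2 fun y hy =>
        (hval y hy).resolve_left fun h => hqt (h ▸ hy)]

end Maximizer

section Minimizer

variable {n k : ℕ} {ε : ℝ} {s t : Multiset ℝ} {x y z : ℝ}

theorem continuous_coeff_mul {f g : ℝ → PowerSeries ℝ}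
    (hf : ∀ j, Continuous fun δ => PowerSeries.coeff j (f δ))
    (hg : ∀ j, Continuous fun δ => PowerSeries.coeff j (g δ)) (j : ℕ) :
    Continuous fun δ => PowerSeries.coeff j (f δ * g δ) := by
  simp only [PowerSeries.coeff_mul]
  exact continuous_finsetSum _ fun i _ => (hf _).mul (hg _)

theorem first_variation_nonpos_of_isMinOn (hs : s ∈ centredMultisets n)
    (hmin : IsMinOn (fun s => perturbedCoeff k ε (chsSeries s)) (centredMultisets n) s)
    (hst : s = x ::ₘ y ::ₘ z ::ₘ t) (hxy : x ≤ y) (hyz : y < z) :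
    perturbedCoeff k ε (PowerSeries.X ^ 3 * chsSeries (x ::ₘ y ::ₘ z ::ₘ s)) ≤ 0 := by
  obtain ⟨u, v, hu, hv, hu0, hv0, h⟩ := exists_deformation (z := z) hxy
  have hcont : Continuous fun δ => perturbedCoeff k ε
      (PowerSeries.X ^ 3 * chsSeries (u δ ::ₘ v δ ::ₘ (z - δ) ::ₘ s)) := by
    have hc : ∀ j, Continuous fun δ => PowerSeries.coeff j
        (PowerSeries.X ^ 3 * chsSeries (u δ ::ₘ v δ ::ₘ (z - δ) ::ₘ s)) := by
      simp only [chsSeries_cons]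
      refine continuous_coeff_mul (fun j => continuous_const) (continuous_coeff_mul ?_
        (continuous_coeff_mul ?_ (continuous_coeff_mul ?_ fun j => continuous_const)))
      all_goals
        intro j
        simp only [coeff_geomSeries]
        fun_prop
    simp only [perturbedCoeff_apply]
    exact (hc _).add (continuous_const.mul ((hc _).add (hc _)))
  have hlim := (hcont.tendsto 0).mono_left (nhdsWithin_le_nhds (s := Set.Ioi 0))
  simp only [hu0, hv0, sub_zero] at hlim
  refine le_of_tendsto hlim ?_
  filter_upwards [Ioo_mem_nhdsGT (sub_pos.2 hyz)] with δ hδ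
  obtain ⟨h1, h2, h3⟩ := h δ hδ
  subst hst
  have hle : perturbedCoeff k ε (chsSeries (x ::ₘ y ::ₘ z ::ₘ t)) ≤
    perturbedCoeff k ε (chsSeries (u δ ::ₘ v δ ::ₘ (z - δ) ::ₘ t)) :=
    hmin (replace_mem_centredMultisets hs h1 h2)
  have e1 := perturbedCoeff_triple_sub k ε t h1 h2
  by_contra! hpos
  have := mul_neg_of_neg_of_pos (sub_neg.2 h3) hpos
  linarith

theorem first_variation_nonneg_of_isMinOn (hs : s ∈ centredMultisets n)
    (hmin : IsMinOn (fun s => perturbedCoeff k ε (chsSeries s)) (centredMultisets n) s)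
    (hst : s = x ::ₘ y ::ₘ z ::ₘ t) (hxy : x < y) (hyz : y ≤ z) :
    0 ≤ perturbedCoeff k ε (PowerSeries.X ^ 3 * chsSeries (x ::ₘ y ::ₘ z ::ₘ s)) := by
  have h := first_variation_nonpos_of_isMinOn (k := k) (ε := ε) (s := s.map (-·))
    (t := t.map (-·)) (x := -z) (y := -y) (z := -x) (neg_mem_centredMultisets hs)
    (fun r hr => by simpa only [Set.mem_ofPred_eq, perturbedCoeff_neg] using hmin hr)
    (by subst hst; simp [Multiset.cons_swap]) (by linarith) (by linarith)
  have e : (-z) ::ₘ (-y) ::ₘ (-x) ::ₘ s.map (-·) = (x ::ₘ y ::ₘ z ::ₘ s).map (-·) := by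
    simp [Multiset.cons_swap]
  rw [e, perturbedCoeff_X_pow_mul_neg] at h
  linarith

/-- A minimizer has at most one element strictly between its smallest and its largest one. -/
theorem exists_eq_cons_of_isMinOn (hε : 0 < ε) (hs : s ∈ centredMultisets n)
    (hmin : IsMinOn (fun s => perturbedCoeff k ε (chsSeries s)) (centredMultisets n) s) :
    ∃ p q r t, s = r ::ₘ t ∧ q < p ∧ q ≤ r ∧ r ≤ p ∧ q ∈ s ∧ p ∈ s ∧ ∀ y ∈ t, y = p ∨ y = q := by
  obtain ⟨q, p, t, hst, hqp, hbd⟩ := exists_min_max_of_mem_centredMultisets hs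
  have hq : q ∈ s := by simp [hst]
  have hp : p ∈ s := by simp [hst]
  by_cases hval : ∀ y ∈ t, y = p ∨ y = q
  · refine ⟨p, q, q, p ::ₘ t, hst, hqp, le_rfl, hqp.le, hq, hp, fun y hy => ?_⟩
    rcases Multiset.mem_cons.1 hy with rfl | hy
    · exact Or.inl rfl
    · exact hval y hy
  push Not at hval
  obtain ⟨r, hr, hrp, hrq⟩ := hval
  obtain ⟨t, rfl⟩ := Multiset.exists_cons_of_mem hr
  obtain ⟨hqr, hrp'⟩ := hbd r (by simp [hst])
  refine ⟨p, q, r, q ::ₘ p ::ₘ t, by rw [hst, Multiset.cons_swap p r, Multiset.cons_swap q r],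
    hqp, hqr, hrp', hq, hp, fun y hy => ?_⟩
  simp only [Multiset.mem_cons] at hy
  rcases hy with rfl | rfl | hy
  · exact Or.inr rfl
  · exact Or.inl rfl
  by_contra! hne
  obtain ⟨t, rfl⟩ := Multiset.exists_cons_of_mem hy
  obtain ⟨hqy, hyp⟩ := hbd y (by simp [hst])
  -- By symmetry, `r ≤ y` may be assumed for the two elements strictly between `q` and `p`.
  wlog hry : r ≤ y generalizing r y
  · exact this y hne.1 hne.2 hqy hyp r ⟨hrp, hrq⟩ (by rw [hst, Multiset.cons_swap r y])
      (by simp) (by simp) hqr hrp' (le_of_not_ge hry)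
  have h1 := first_variation_nonneg_of_isMinOn (x := q) (y := r) (z := p) (t := y ::ₘ t) hs hmin
    (by rw [hst, Multiset.cons_swap p r]) (lt_of_le_of_ne hqr hrq.symm) hrp'
  have h2 := first_variation_nonpos_of_isMinOn (x := r) (y := y) (z := p) (t := q ::ₘ t) hs hmin
    (by rw [hst, Multiset.cons_swap p r, Multiset.cons_swap q r, Multiset.cons_swap p y,
      Multiset.cons_swap q y, Multiset.cons_swap q p]) hry (lt_of_le_of_ne hyp hne.1)
  have h3 := perturbedCoeff_X_pow_three_lt k hε (lt_of_le_of_ne hqy hne.2.symm) (r ::ₘ p ::ₘ s)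
  rw [Multiset.cons_swap y r] at h3
  linarith

end Minimizer

/-! ### Power sums and Newton's identities -/

theorem tangent_le_pow {x u : ℝ} (hx : 0 ≤ x) (hu : 0 < u) (j : ℕ) :
    (j + 1) * u ^ j * x - j * u ^ (j + 1) ≤ x ^ (j + 1) := by
  have h := one_add_mul_sub_le_pow (a := x / u) (by linarith [div_nonneg hx hu.le]) (j + 1)
  rw [div_pow, le_div_iff₀ (pow_pos hu _)] at h
  refine le_trans (le_of_eq ?_) h
  push_cast
  field_simp
  ring

/-- The power mean inequality, summed from the tangents to `x ↦ x ^ (i + 1)` at `1 / n`. -/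
theorem inv_pow_le_sum_even_pow {n : ℕ} {s : Multiset ℝ} (hs : s ∈ centredMultisets n) (i : ℕ) :
    ((n : ℝ)⁻¹) ^ i ≤ (s.map (· ^ (2 * i + 2))).sum := by
  obtain ⟨hc, -, hsq⟩ := hs
  have hn : 0 < n := by
    rw [← hc, Multiset.card_pos]
    rintro rfl
    simp at hsq
  have hn' : (0 : ℝ) < n := by exact_mod_cast hn
  have h := Multiset.sum_map_le_sum_map (s := s)
    (fun y : ℝ => (i + 1) * (n : ℝ)⁻¹ ^ i * y ^ 2 + -(i * (n : ℝ)⁻¹ ^ (i + 1)))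
    (fun y => y ^ (2 * i + 2)) (fun y _ => by
      have := tangent_le_pow (sq_nonneg y) (inv_pos.2 hn') i
      rw [← pow_mul] at this
      rw [show 2 * i + 2 = 2 * (i + 1) by ring]
      linarith)
  rw [Multiset.sum_map_add, Multiset.sum_map_mul_left, hsq, Multiset.map_const',
    Multiset.sum_replicate, hc, nsmul_eq_mul] at h
  refine le_trans (le_of_eq ?_) h
  linear_combination (i * (n : ℝ)⁻¹ ^ i) * mul_inv_cancel₀ hn'.ne'

/-- The power sums of odd degree of a multiset with sum zero are all of one sign if all negative
elements are equal, say to `-u`, and all nonnegative ones but at most one, `r`, are equal to the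
largest element. If no element
exceeds `u`, then `y ^ (2 j + 1) ≤ u ^ (2 j) y` for each element. Otherwise, the nonnegative
elements do not outnumber the negative ones, and the tangent at `u` gives a lower bound. -/
theorem sum_odd_pow_sign_of_nonneg {p q r : ℝ} {t : Multiset ℝ} (hsum : (r ::ₘ t).sum = 0)
    (hqp : q < p) (hr : 0 ≤ r) (hrp : r ≤ p) (hp : p ∈ r ::ₘ t) (ht : ∀ y ∈ t, y = p ∨ y = q) :
    (∀ j : ℕ, 0 ≤ ((r ::ₘ t).map (· ^ (2 * j + 1))).sum) ∨
      (∀ j : ℕ, ((r ::ₘ t).map (· ^ (2 * j + 1))).sum ≤ 0) := by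
  have hp0 : 0 ≤ p := hr.trans hrp
  have hq : q < 0 := by
    by_contra! hq
    have hle := Multiset.single_le_sum (s := r ::ₘ t) (fun y hy => by
      rcases Multiset.mem_cons.1 hy with rfl | hy
      · exact hr
      · rcases ht y hy with rfl | rfl <;> assumption) p hp
    linarith
  have hval : ∀ y ∈ r ::ₘ t, (0 ≤ y ∧ y ≤ p) ∨ y = q := by
    intro y hy
    rcases Multiset.mem_cons.1 hy with rfl | hy
    · exact Or.inl ⟨hr, hrp⟩
    · rcases ht y hy with rfl | rfl
      · exact Or.inl ⟨hp0, le_rfl⟩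
      · exact Or.inr rfl
  obtain ⟨u, rfl⟩ : ∃ u, q = -u := ⟨-q, by ring⟩
  have hu : 0 < u := by linarith
  rcases le_or_gt p u with hpu | hpu
  · right
    intro j
    have h := Multiset.sum_map_le_sum_map (s := r ::ₘ t) (fun y : ℝ => y ^ (2 * j + 1))
      (fun y => u ^ (2 * j) * y) (fun y hy => by
        rcases hval y hy with ⟨hy0, hyp⟩ | rfl
        · rw [pow_succ]
          exact mul_le_mul_of_nonneg_right (pow_le_pow_left₀ hy0 (hyp.trans hpu) _) hy0
        · rw [pow_succ, (even_two_mul j).neg_pow])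
    rwa [Multiset.sum_map_mul_left, Multiset.map_id', hsum, mul_zero] at h
  · left
    intro j
    set σ : ℝ → ℤ := fun y => if 0 ≤ y then 1 else -1 with hσ
    have hσpos : ∀ y, 0 ≤ y → σ y = 1 := fun y hy => if_pos hy
    have hσneg : σ (-u) = -1 := if_neg (by linarith)
    have hcast : ∀ s : Multiset ℝ, (s.map fun y => (σ y : ℝ)).sum = ((s.map σ).sum : ℤ) := by
      intro s
      rw [Int.cast_multiset_sum, Multiset.map_map]
      rfl
    have hN : ((r ::ₘ t).map σ).sum ≤ 0 := by
      -- Every element `y` of `t` is at least `u σ y`, and `r ≥ u σ r - u`; as `p > u`, the sum of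
      -- all elements is greater than `u (∑ σ) - u`, so that the integer `∑ σ` is less than `1`.
      have hnonneg : ∀ w ∈ t.map fun y => y - u * σ y, 0 ≤ w := by
        intro w hw
        obtain ⟨y, hy, rfl⟩ := Multiset.mem_map.1 hw
        rcases ht y hy with rfl | rfl
        · rw [hσpos _ hp0]
          push_cast
          linarith
        · rw [hσneg]
          push_cast
          linarith
      have ht0 : (t.map fun y => y - u * σ y).sum = t.sum - u * ((t.map σ).sum : ℤ) := by
        rw [Multiset.sum_map_sub, Multiset.sum_map_mul_left, hcast, Multiset.map_id']
      have hgt : 0 < r + (t.map fun y => y - u * σ y).sum := by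
        rcases Multiset.mem_cons.1 hp with rfl | hpt
        · exact add_pos_of_pos_of_nonneg (hu.trans hpu) (Multiset.sum_nonneg hnonneg)
        · have := Multiset.single_le_sum hnonneg _ (Multiset.mem_map_of_mem _ hpt)
          rw [hσpos _ hp0] at this
          push_cast at this
          linarith
      rw [Multiset.sum_cons] at hsum
      rw [Multiset.map_cons, Multiset.sum_cons, hσpos r hr]
      have hlt : ((t.map σ).sum : ℤ) < (0 : ℝ) := by
        by_contra! h
        have := mul_nonneg hu.le h
        linarith
      have : (t.map σ).sum < 0 := by exact_mod_cast hlt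
      omega
    have h := Multiset.sum_map_le_sum_map (s := r ::ₘ t)
      (fun y : ℝ => (2 * j + 1) * u ^ (2 * j) * y - 2 * j * u ^ (2 * j + 1) * σ y)
      (fun y => y ^ (2 * j + 1)) (fun y hy => by
        rcases hval y hy with ⟨hy0, -⟩ | rfl
        · have := tangent_le_pow hy0 hu (2 * j)
          rw [hσpos y hy0]
          push_cast at this ⊢
          linarith
        · rw [hσneg, pow_succ (-u), (even_two_mul j).neg_pow, pow_succ]
          push_cast
          exact le_of_eq (by ring))
    rw [Multiset.sum_map_sub, Multiset.sum_map_mul_left, Multiset.sum_map_mul_left, hcast,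
      Multiset.map_id', hsum, mul_zero, zero_sub] at h
    refine le_trans (neg_nonneg.2 (mul_nonpos_of_nonneg_of_nonpos (by positivity) ?_)) h
    exact_mod_cast hN

theorem sum_odd_pow_neg (s : Multiset ℝ) (j : ℕ) :
    ((s.map (-·)).map (· ^ (2 * j + 1))).sum = -(s.map (· ^ (2 * j + 1))).sum := by
  rw [Multiset.map_map, ← Multiset.sum_map_neg']
  have h : ∀ y : ℝ, (-y) ^ (2 * j + 1) = -y ^ (2 * j + 1) :=
    fun y => (odd_two_mul_add_one j).neg_pow y
  simp only [Function.comp_def, h, Multiset.map_map]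

theorem sum_odd_pow_sign {p q r : ℝ} {t : Multiset ℝ} (hsum : (r ::ₘ t).sum = 0) (hqp : q < p)
    (hqr : q ≤ r) (hrp : r ≤ p) (hq : q ∈ r ::ₘ t) (hp : p ∈ r ::ₘ t)
    (ht : ∀ y ∈ t, y = p ∨ y = q) :
    (∀ j : ℕ, 0 ≤ ((r ::ₘ t).map (· ^ (2 * j + 1))).sum) ∨
      (∀ j : ℕ, ((r ::ₘ t).map (· ^ (2 * j + 1))).sum ≤ 0) := by
  rcases le_total 0 r with hr | hr
  · exact sum_odd_pow_sign_of_nonneg hsum hqp hr hrp hp ht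
  · have h := sum_odd_pow_sign_of_nonneg (p := -q) (q := -p) (r := -r) (t := t.map (-·))
      (by rw [← Multiset.map_cons (-·), Multiset.sum_map_neg', hsum, neg_zero])
      (by linarith) (by linarith) (by linarith)
      (by rw [← Multiset.map_cons (-·)]; exact Multiset.mem_map_of_mem _ hq) (by
        intro w hw
        obtain ⟨y, hy, rfl⟩ := Multiset.mem_map.1 hw
        rcases ht y hy with rfl | rfl
        · exact Or.inr rfl
        · exact Or.inl rfl)
    rw [← Multiset.map_cons (-·)] at h
    simp only [sum_odd_pow_neg] at h
    rcases h with h | h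
    · exact Or.inr fun j => by linarith [h j]
    · exact Or.inl fun j => by linarith [h j]

/-- Newton's identities for the complete homogeneous symmetric polynomials: the logarithmic
derivative of the generating series is the generating series of the power sums. -/
theorem newton_chsSeries (s : Multiset ℝ) (m : ℕ) :
    (m : ℝ) * PowerSeries.coeff m (chsSeries s) = ∑ ij ∈ Finset.HasAntidiagonal.antidiagonal m,
      (if ij.1 = 0 then 0 else (s.map (· ^ ij.1)).sum) * PowerSeries.coeff ij.2 (chsSeries s) := by
  open PowerSeries in
  have hgeom : ∀ a, d⁄dX ℝ (geomSeries a) = C a * geomSeries a * geomSeries a := by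
    intro a
    have h1 := one_sub_mul_geomSeries a
    have h2 := congrArg (d⁄dX ℝ) h1
    simp only [Derivation.leibniz, map_sub, Derivation.map_one_eq_zero, derivative_C,
      derivative_X, smul_eq_mul] at h2
    linear_combination geomSeries a * h2 - d⁄dX ℝ (geomSeries a) * h1
  have hder : X * d⁄dX ℝ (chsSeries s) =
      (s.map fun a => C a * X * geomSeries a).sum * chsSeries s := by
    induction s using Multiset.induction_on with
    | empty => simp
    | cons a s ih =>
      rw [chsSeries_cons, Derivation.leibniz, Multiset.map_cons, Multiset.sum_cons, hgeom]
      simp only [smul_eq_mul]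
      linear_combination geomSeries a * ih
  have hcoeff : ∀ j, coeff j (s.map fun a => C a * X * geomSeries a).sum =
      if j = 0 then 0 else (s.map (· ^ j)).sum := by
    intro j
    rw [map_multiset_sum, Multiset.map_map]
    rcases j with _ | j
    · simp
    · rw [if_neg (Nat.succ_ne_zero j)]
      refine congrArg Multiset.sum (Multiset.map_congr rfl fun a _ => ?_)
      rw [Function.comp_apply, mul_assoc, coeff_C_mul, coeff_succ_X_mul, coeff_geomSeries,
        pow_succ']
  have h := congrArg (coeff m) hder
  rw [coeff_mul m (Multiset.sum _)] at h
  simp only [hcoeff] at h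
  rw [← h]
  rcases m with _ | m
  · simp
  · rw [coeff_succ_X_mul, coeff_derivative]
    push_cast
    ring

theorem sum_antidiagonal_two_mul_add_two {f : ℕ × ℕ → ℝ} (hf : ∀ j, f (0, j) = 0) (k : ℕ) :
    ∑ ij ∈ Finset.HasAntidiagonal.antidiagonal (2 * k + 2), f ij =
      ∑ ij ∈ Finset.HasAntidiagonal.antidiagonal k, f (2 * ij.1 + 2, 2 * ij.2) +
        ∑ ij ∈ Finset.HasAntidiagonal.antidiagonal (2 * k + 2) with Odd ij.1, f ij := by
  rw [← Finset.sum_filter_not_add_sum_filter _ fun ij : ℕ × ℕ => Odd ij.1]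
  congr 1
  symm
  refine Finset.sum_of_injOn (fun ij : ℕ × ℕ => (2 * ij.1 + 2, 2 * ij.2)) ?_ ?_ ?_ ?_
  · rintro ⟨a, b⟩ - ⟨c, d⟩ - h
    simp only [Prod.mk.injEq] at h ⊢
    omega
  · rintro ⟨a, b⟩ h
    simp only [Finset.coe_filter, Finset.mem_coe, Finset.HasAntidiagonal.mem_antidiagonal,
      Set.mem_ofPred_eq, Nat.not_odd_iff_even] at h ⊢
    exact ⟨by omega, by simp [Nat.even_add]⟩
  · rintro ⟨a, b⟩ h hn
    simp only [Finset.mem_filter, Finset.HasAntidiagonal.mem_antidiagonal,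
      Nat.not_odd_iff_even] at h
    obtain ⟨h, c, rfl⟩ := h
    rcases c with _ | c
    · exact hf b
    · refine absurd ⟨(c, k - c), ?_, ?_⟩ hn
      · simp only [Finset.mem_coe, Finset.HasAntidiagonal.mem_antidiagonal]
        omega
      · simp only [Prod.mk.injEq]
        omega
  · intro ij _
    rfl

/-- The coefficient of `X ^ (2 k)` in `(1 - X ^ 2 / n) ^ (-n / 2)`. -/
noncomputable def balancedCoeff (n k : ℕ) : ℝ :=
  ∏ i ∈ Finset.range k, ((n : ℝ) / 2 + i) / (n * (i + 1))

theorem balancedCoeff_succ (n k : ℕ) :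
    balancedCoeff n (k + 1) = balancedCoeff n k * (((n : ℝ) / 2 + k) / (n * (k + 1))) :=
  Finset.prod_range_succ _ _

theorem balancedCoeff_nonneg (n k : ℕ) : 0 ≤ balancedCoeff n k :=
  Finset.prod_nonneg fun _ _ => by positivity

theorem two_mul_balancedCoeff_succ {n : ℕ} (hn : 0 < n) (k : ℕ) :
    (2 * k + 2) * balancedCoeff n (k + 1) =
      ∑ ij ∈ Finset.HasAntidiagonal.antidiagonal k, (n : ℝ)⁻¹ ^ ij.1 * balancedCoeff n ij.2 := by
  have hn' : (n : ℝ) ≠ 0 := by positivity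
  induction k with
  | zero =>
    simp [balancedCoeff]
    field_simp
  | succ k ih =>
    rw [Finset.Nat.antidiagonal_succ, Finset.sum_cons, Finset.sum_map]
    simp only [Function.Embedding.prodMap, Function.Embedding.coeFn_mk, Prod.map_fst, Prod.map_snd,
      Function.Embedding.refl_apply, Nat.succ_eq_add_one, pow_succ', mul_assoc]
    rw [← Finset.mul_sum, ← ih, balancedCoeff_succ n (k + 1)]
    have : ((k : ℝ) + 1 + 1) ≠ 0 := by positivity
    push_cast
    field_simp

theorem balancedCoeff_le_of_sum_odd_pow_nonneg {n : ℕ} {s : Multiset ℝ}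
    (hs : s ∈ centredMultisets n) (hodd : ∀ j : ℕ, 0 ≤ (s.map (· ^ (2 * j + 1))).sum) (k : ℕ) :
    balancedCoeff n k ≤ PowerSeries.coeff (2 * k) (chsSeries s) := by
  have hp : ∀ j, 0 ≤ (s.map (· ^ j)).sum := by
    intro j
    rcases Nat.even_or_odd' j with ⟨i, rfl | rfl⟩
    · refine Multiset.sum_nonneg fun w hw => ?_
      obtain ⟨y, -, rfl⟩ := Multiset.mem_map.1 hw
      exact (even_two_mul i).pow_nonneg y
    · exact hodd i
  have hp' : ∀ j, 0 ≤ if j = 0 then 0 else (s.map (· ^ j)).sum := by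
    intro j
    split_ifs
    exacts [le_rfl, hp j]
  have hcoeff : ∀ m, 0 ≤ PowerSeries.coeff m (chsSeries s) := by
    intro m
    induction m using Nat.strong_induction_on with
    | _ m ih =>
      rcases m.eq_zero_or_pos with rfl | hm
      · simp
      refine nonneg_of_mul_nonneg_right ((newton_chsSeries s m).symm ▸ Finset.sum_nonneg ?_)
        (Nat.cast_pos.2 hm)
      rintro ⟨i, j⟩ hij
      rw [Finset.HasAntidiagonal.mem_antidiagonal] at hij
      rcases i.eq_zero_or_pos with rfl | hi
      · simp
      · exact mul_nonneg (hp' i) (ih j (by simp only at hij; omega))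
  have hn : 0 < n := by
    obtain ⟨q, p, t, hst, -⟩ := exists_min_max_of_mem_centredMultisets hs
    rw [← hs.1, hst]
    simp
  induction k using Nat.strong_induction_on with
  | _ k ih =>
    rcases k with _ | k
    · simp [balancedCoeff]
    have h := newton_chsSeries s (2 * k + 2)
    rw [sum_antidiagonal_two_mul_add_two (fun j => by simp)] at h
    have hrest : 0 ≤ ∑ ij ∈ Finset.HasAntidiagonal.antidiagonal (2 * k + 2) with Odd ij.1,
        (if ij.1 = 0 then 0 else (s.map (· ^ ij.1)).sum) *
          PowerSeries.coeff ij.2 (chsSeries s) :=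
      Finset.sum_nonneg fun ij _ => mul_nonneg (hp' _) (hcoeff _)
    have hmain : ∑ ij ∈ Finset.HasAntidiagonal.antidiagonal k,
        (n : ℝ)⁻¹ ^ ij.1 * balancedCoeff n ij.2 ≤
        ∑ ij ∈ Finset.HasAntidiagonal.antidiagonal k,
          (if 2 * ij.1 + 2 = 0 then 0 else (s.map (· ^ (2 * ij.1 + 2))).sum) *
            PowerSeries.coeff (2 * ij.2) (chsSeries s) := by
      refine Finset.sum_le_sum fun ij hij => ?_
      rw [Finset.HasAntidiagonal.mem_antidiagonal] at hij
      rw [if_neg (by omega)]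
      exact mul_le_mul (inv_pow_le_sum_even_pow hs _) (ih _ (by omega)) (balancedCoeff_nonneg _ _)
        (hp _)
    rw [← two_mul_balancedCoeff_succ hn] at hmain
    rw [Nat.cast_add, Nat.cast_mul, Nat.cast_ofNat] at h
    have h2 : (2 * (k : ℝ) + 2) * balancedCoeff n (k + 1) ≤
        (2 * k + 2) * PowerSeries.coeff (2 * k + 2) (chsSeries s) := by linarith
    exact le_of_mul_le_mul_left h2 (by positivity)

theorem balancedCoeff_le_of_sum_odd_pow_sign {n : ℕ} {s : Multiset ℝ}
    (hs : s ∈ centredMultisets n)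
    (hodd : (∀ j : ℕ, 0 ≤ (s.map (· ^ (2 * j + 1))).sum) ∨
      (∀ j : ℕ, (s.map (· ^ (2 * j + 1))).sum ≤ 0)) (k : ℕ) :
    balancedCoeff n k ≤ PowerSeries.coeff (2 * k) (chsSeries s) := by
  rcases hodd with hodd | hodd
  · exact balancedCoeff_le_of_sum_odd_pow_nonneg hs hodd k
  · have h := balancedCoeff_le_of_sum_odd_pow_nonneg (neg_mem_centredMultisets hs)
      (fun j => by rw [sum_odd_pow_neg]; linarith [hodd j]) k
    rwa [coeff_chsSeries_neg, (even_two_mul k).neg_one_pow, one_mul] at h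

/-! ### Extremal values over multisets -/

theorem map_mem_centredMultisets {n : ℕ} {a : Fin n → ℝ} :
    Finset.univ.val.map a ∈ centredMultisets n ↔ a ∈ centredSphere n := by
  simp only [centredMultisets, centredSphere, Set.mem_ofPred_eq, Multiset.card_map,
    Finset.card_val, Finset.card_univ, Fintype.card_fin, true_and, Multiset.map_map]
  rfl

theorem exists_eq_map_of_card_eq {n : ℕ} {s : Multiset ℝ} (hs : s.card = n) :
    ∃ a : Fin n → ℝ, s = Finset.univ.val.map a := by
  obtain ⟨l, rfl⟩ : ∃ l : List ℝ, (l : Multiset ℝ) = s := ⟨s.toList, s.coe_toList⟩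
  subst hs
  have h : Finset.univ.val.map l.get = (l : Multiset ℝ) := by
    rw [Fin.univ_val_map, List.ofFn_get]
  exact ⟨l.get, h.symm⟩

theorem isCompact_centredSphere (n : ℕ) : IsCompact (centredSphere n) := by
  refine isCompact_Icc.of_isClosed_subset (s := Set.Icc (fun _ => -1) (fun _ => 1)) ?_ ?_
  · exact (isClosed_eq (by fun_prop) continuous_const).inter
      (isClosed_eq (by fun_prop) continuous_const)
  · rintro a ⟨-, ha⟩
    have h : ∀ i, |a i| ≤ 1 := fun i => by
      rw [← sq_le_one_iff_abs_le_one, ← ha]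
      exact Finset.single_le_sum (f := fun i => a i ^ 2) (fun j _ => sq_nonneg (a j))
        (Finset.mem_univ i)
    exact ⟨fun i => (abs_le.1 (h i)).1, fun i => (abs_le.1 (h i)).2⟩

theorem continuous_perturbedCoeff_map (n k : ℕ) (ε : ℝ) :
    Continuous fun a : Fin n → ℝ => perturbedCoeff k ε (chsSeries (Finset.univ.val.map a)) := by
  have h : ∀ m, Continuous fun a : Fin n → ℝ => chs m a := fun m => MvPolynomial.continuous_eval _
  simp only [perturbedCoeff_apply, ← chs_eq_coeff_chsSeries]
  exact (h _).add (continuous_const.mul ((h _).add (h _)))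

theorem exists_isMinOn_centredMultisets {n : ℕ} (h : (centredMultisets n).Nonempty) (k : ℕ)
    (ε : ℝ) : ∃ s ∈ centredMultisets n,
      IsMinOn (fun s => perturbedCoeff k ε (chsSeries s)) (centredMultisets n) s := by
  obtain ⟨s₀, hs₀⟩ := h
  obtain ⟨a₀, rfl⟩ := exists_eq_map_of_card_eq hs₀.1
  obtain ⟨a, ha, hmin⟩ := (isCompact_centredSphere n).exists_isMinOn
    ⟨a₀, map_mem_centredMultisets.1 hs₀⟩ (continuous_perturbedCoeff_map n k ε).continuousOn
  refine ⟨_, map_mem_centredMultisets.2 ha, fun s hs => ?_⟩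
  obtain ⟨b, rfl⟩ := exists_eq_map_of_card_eq hs.1
  exact hmin (map_mem_centredMultisets.1 hs)

theorem exists_isMaxOn_centredMultisets {n : ℕ} (h : (centredMultisets n).Nonempty) (k : ℕ)
    (ε : ℝ) : ∃ s ∈ centredMultisets n,
      IsMaxOn (fun s => perturbedCoeff k ε (chsSeries s)) (centredMultisets n) s := by
  obtain ⟨s₀, hs₀⟩ := h
  obtain ⟨a₀, rfl⟩ := exists_eq_map_of_card_eq hs₀.1
  obtain ⟨a, ha, hmax⟩ := (isCompact_centredSphere n).exists_isMaxOn
    ⟨a₀, map_mem_centredMultisets.1 hs₀⟩ (continuous_perturbedCoeff_map n k ε).continuousOn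
  refine ⟨_, map_mem_centredMultisets.2 ha, fun s hs => ?_⟩
  obtain ⟨b, rfl⟩ := exists_eq_map_of_card_eq hs.1
  exact hmax (map_mem_centredMultisets.1 hs)

theorem le_of_forall_pos_add_mul_le {a b c d : ℝ} (h : ∀ ε > 0, a + ε * b ≤ c + ε * d) :
    a ≤ c := by
  have key : ∀ x y : ℝ,
      Filter.Tendsto (fun ε => x + ε * y) (nhdsWithin 0 (Set.Ioi 0)) (nhds x) := by
    intro x y
    have hc : Continuous fun ε : ℝ => x + ε * y := by fun_prop
    simpa using (hc.tendsto 0).mono_left nhdsWithin_le_nhds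
  refine le_of_tendsto_of_tendsto (key a b) (key c d) ?_
  filter_upwards [self_mem_nhdsWithin] with ε hε using h ε hε

/-- The lower bound, valid for every `n`, even or odd. -/
theorem balancedCoeff_le_coeff_chsSeries {n : ℕ} {s : Multiset ℝ} (hs : s ∈ centredMultisets n)
    (k : ℕ) : balancedCoeff n k ≤ PowerSeries.coeff (2 * k) (chsSeries s) := by
  refine le_of_forall_pos_add_mul_le (b := balancedCoeff n 2 + balancedCoeff n 3)
    (d := PowerSeries.coeff 4 (chsSeries s) + PowerSeries.coeff 6 (chsSeries s)) fun ε hε => ?_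
  obtain ⟨m, hm, hmin⟩ := exists_isMinOn_centredMultisets ⟨s, hs⟩ k ε
  obtain ⟨p, q, r, t, rfl, hqp, hqr, hrp, hq, hp, ht⟩ := exists_eq_cons_of_isMinOn hε hm hmin
  have h := balancedCoeff_le_of_sum_odd_pow_sign hm (sum_odd_pow_sign hm.2.1 hqp hqr hrp hq hp ht)
  have hle : perturbedCoeff k ε (chsSeries (r ::ₘ t)) ≤ perturbedCoeff k ε (chsSeries s) := hmin hs
  rw [perturbedCoeff_apply, perturbedCoeff_apply] at hle
  have h2 := mul_le_mul_of_nonneg_left (add_le_add (h 2) (h 3)) hε.le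
  linarith [h k]

/-- If all elements are `±1 / √n` and their sum is zero, then the power sums of odd degree vanish
and Newton's identities become the recursion that `balancedCoeff` satisfies. -/
theorem coeff_chsSeries_eq_of_sq_eq {n : ℕ} (hn : 0 < n) {s : Multiset ℝ} (hc : s.card = n)
    (hsum : s.sum = 0) (hsq : ∀ y ∈ s, y ^ 2 = (n : ℝ)⁻¹) (k : ℕ) :
    PowerSeries.coeff (2 * k) (chsSeries s) = balancedCoeff n k := by
  have hn' : (n : ℝ) ≠ 0 := by positivity
  have heven : ∀ i, (s.map (· ^ (2 * i + 2))).sum = (n : ℝ)⁻¹ ^ i := by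
    intro i
    rw [Multiset.map_congr (Eq.refl s) (g := fun _ => (n : ℝ)⁻¹ ^ (i + 1)) fun y hy => by
      rw [← hsq y hy, ← pow_mul, mul_add, mul_one], Multiset.map_const', Multiset.sum_replicate, hc,
      nsmul_eq_mul, pow_succ', mul_inv_cancel_left₀ hn']
  have hodd : ∀ j, Odd j → (s.map (· ^ j)).sum = 0 := by
    rintro _ ⟨j, rfl⟩
    rw [Multiset.map_congr (Eq.refl s) (g := fun y => (n : ℝ)⁻¹ ^ j * y) fun y hy => by
      rw [← hsq y hy, ← pow_mul, ← pow_succ], Multiset.sum_map_mul_left, Multiset.map_id', hsum,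
      mul_zero]
  induction k using Nat.strong_induction_on with
  | _ k ih =>
    rcases k with _ | k
    · simp [balancedCoeff]
    have h := newton_chsSeries s (2 * k + 2)
    rw [sum_antidiagonal_two_mul_add_two (fun j => by simp),
      Finset.sum_eq_zero (s := Finset.filter _ _) fun ij hij => ?_, add_zero,
      Finset.sum_congr rfl fun ij hij => ?_, ← two_mul_balancedCoeff_succ hn, Nat.cast_add,
      Nat.cast_mul, Nat.cast_ofNat] at h
    · exact mul_left_cancel₀ (by positivity) h
    · rw [Finset.HasAntidiagonal.mem_antidiagonal] at hij
      rw [if_neg (by omega), heven, ih _ (by omega)]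
    · have hj := (Finset.mem_filter.1 hij).2
      rw [hodd _ hj]
      simp

theorem balancedCoeff_eq {n : ℕ} (hn : 2 ≤ n) (he : Even n) (k : ℕ) :
    balancedCoeff n k =
      ((n / 2 + k - 1)! : ℝ) / ((k ! : ℝ) * ((n / 2 - 1)! : ℝ) * (n : ℝ) ^ k) := by
  obtain ⟨m, rfl⟩ := he
  obtain ⟨m, rfl⟩ : ∃ j, m = j + 1 := ⟨m - 1, by omega⟩
  rw [show (m + 1 + (m + 1)) / 2 = m + 1 by omega]
  have hsimp : ∀ k, m + 1 + k - 1 = m + k := by omega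
  rw [hsimp, Nat.add_sub_cancel]
  induction k with
  | zero =>
    have : (m ! : ℝ) ≠ 0 := by positivity
    simp [balancedCoeff, this]
  | succ k ih =>
    rw [balancedCoeff_succ, ih, show m + (k + 1) = m + k + 1 from rfl,
      Nat.factorial_succ, Nat.factorial_succ]
    push_cast
    field_simp
    ring

theorem sqrt_sub_one_div {x : ℝ} (h1 : 0 < x - 1) (h0 : 0 < x) :
    √((x - 1) / x) = (x - 1) / √(x * (x - 1)) := by
  rw [Real.sqrt_eq_iff_mul_self_eq (by positivity) (by positivity), div_mul_div_comm, ← pow_two,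
    ← pow_two, Real.sq_sqrt (mul_pos h0 h1).le]
  field_simp

/-- The upper bound. Up to sign, the maximizer of the perturbed functional is the same for every
`ε`, so it maximizes `h_{2k}` too. -/
theorem coeff_chsSeries_le {n : ℕ} (hn : 2 ≤ n) {s : Multiset ℝ} (hs : s ∈ centredMultisets n)
    (k : ℕ) : PowerSeries.coeff (2 * k) (chsSeries s) ≤ PowerSeries.coeff (2 * k) (chsSeries
      (√(((n : ℝ) - 1) / n) ::ₘ
        Multiset.replicate (n - 1) (-(1 / √((n : ℝ) * ((n : ℝ) - 1)))))) := by
  set w := √(((n : ℝ) - 1) / n) ::ₘ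
    Multiset.replicate (n - 1) (-(1 / √((n : ℝ) * ((n : ℝ) - 1)))) with hw
  refine le_of_forall_pos_add_mul_le
    (b := PowerSeries.coeff 4 (chsSeries s) + PowerSeries.coeff 6 (chsSeries s))
    (d := PowerSeries.coeff 4 (chsSeries w) + PowerSeries.coeff 6 (chsSeries w)) fun ε hε => ?_
  obtain ⟨m, hm, hmax⟩ := exists_isMaxOn_centredMultisets ⟨s, hs⟩ k ε
  obtain ⟨p, q, rfl⟩ := eq_cons_replicate_of_isMaxOn hε hm hmax
  have hle : perturbedCoeff k ε (chsSeries s) ≤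
    perturbedCoeff k ε (chsSeries (p ::ₘ Multiset.replicate (n - 1) q)) := hmax hs
  have hn1 : (0 : ℝ) < (n : ℝ) - 1 := by
    have : (2 : ℝ) ≤ n := by exact_mod_cast hn
    linarith
  have hn0 : (0 : ℝ) < n := by linarith
  obtain ⟨-, hsum, hsq⟩ := hm
  simp only [Multiset.sum_cons, Multiset.map_cons, Multiset.map_replicate, Multiset.sum_replicate,
    nsmul_eq_mul, Nat.cast_pred (show 0 < n by omega)] at hsum hsq
  have hp : p = -((n - 1) * q) := by linarith
  have hr : 0 < √((n : ℝ) * ((n : ℝ) - 1)) := Real.sqrt_pos.2 (mul_pos hn0 hn1)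
  have hr2 := Real.sq_sqrt (mul_pos hn0 hn1).le
  have hspike := sqrt_sub_one_div hn1 hn0
  have hq : (q * √((n : ℝ) * ((n : ℝ) - 1))) ^ 2 = 1 := by
    rw [hp] at hsq
    rw [mul_pow, hr2]
    linear_combination hsq
  have heq : perturbedCoeff k ε (chsSeries (p ::ₘ Multiset.replicate (n - 1) q)) =
      perturbedCoeff k ε (chsSeries w) := by
    rcases mul_self_eq_one_iff.1 ((pow_two _).symm.trans hq) with h | h
    · rw [← perturbedCoeff_neg, hw, Multiset.map_cons, Multiset.map_replicate, hspike, hp,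
        eq_div_of_mul_eq hr.ne' h]
      congr 4
      ring
    · rw [hw, hspike, hp, eq_div_of_mul_eq hr.ne' h]
      congr 4 <;> ring
  rw [heq] at hle
  exact hle

/-! ### The two extremal vectors -/

theorem sum_halfVector {n : ℕ} (he : Even n) : ∑ i, halfVector n i = 0 := by
  obtain ⟨m, rfl⟩ := he
  unfold halfVector
  rw [Fin.sum_univ_eq_sum_range (fun i => if i < (m + m) / 2 then 1 / √((m + m : ℕ) : ℝ) else
    -(1 / √((m + m : ℕ) : ℝ))), Finset.sum_range_add, show (m + m) / 2 = m by omega,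
    Finset.sum_congr rfl fun i hi => if_pos (Finset.mem_range.1 hi),
    Finset.sum_congr (g := fun _ => -(1 / √((m + m : ℕ) : ℝ))) rfl fun i _ => if_neg (by omega)]
  simp

theorem halfVector_sq {n : ℕ} (i : Fin n) : halfVector n i ^ 2 = (n : ℝ)⁻¹ := by
  unfold halfVector
  split_ifs
  all_goals
    rw [← sq_abs]
    simp

theorem halfVector_mem {n : ℕ} (hn : 2 ≤ n) (he : Even n) : halfVector n ∈ centredSphere n := by
  refine ⟨sum_halfVector he, ?_⟩
  have : (n : ℝ) ≠ 0 := by positivity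
  simp [halfVector_sq, this]

theorem chs_halfVector {n : ℕ} (hn : 2 ≤ n) (he : Even n) (k : ℕ) :
    chs (2 * k) (halfVector n) = balancedCoeff n k := by
  have hmem := map_mem_centredMultisets.2 (halfVector_mem hn he)
  rw [chs_eq_coeff_chsSeries, coeff_chsSeries_eq_of_sq_eq (by omega) hmem.1 hmem.2.1]
  intro y hy
  obtain ⟨i, -, rfl⟩ := Multiset.mem_map.1 hy
  exact halfVector_sq i

theorem map_spikeVector {n : ℕ} (hn : 2 ≤ n) :
    Finset.univ.val.map (spikeVector n) = √(((n : ℝ) - 1) / n) ::ₘ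
      Multiset.replicate (n - 1) (-(1 / √((n : ℝ) * ((n : ℝ) - 1)))) := by
  obtain ⟨m, rfl⟩ : ∃ m, n = m + 1 := ⟨n - 1, by omega⟩
  rw [Fin.univ_castSuccEmb, Finset.cons_val, Multiset.map_cons, Finset.map_val, Multiset.map_map]
  congr 1
  · simp [spikeVector]
  · rw [Multiset.eq_replicate]
    refine ⟨by simp, fun y hy => ?_⟩
    obtain ⟨i, -, rfl⟩ := Multiset.mem_map.1 hy
    exact if_neg (by simpa using i.2.ne)

theorem spikeVector_mem {n : ℕ} (hn : 2 ≤ n) : spikeVector n ∈ centredSphere n := by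
  have hn1 : (0 : ℝ) < (n : ℝ) - 1 := by
    have : (2 : ℝ) ≤ n := by exact_mod_cast hn
    linarith
  have hn0 : (0 : ℝ) < n := by linarith
  have hr : 0 < √((n : ℝ) * ((n : ℝ) - 1)) := Real.sqrt_pos.2 (mul_pos hn0 hn1)
  have hr2 := Real.sq_sqrt (mul_pos hn0 hn1).le
  have hspike := sqrt_sub_one_div hn1 hn0
  rw [← map_mem_centredMultisets, map_spikeVector hn]
  refine ⟨by simp; omega, ?_, ?_⟩
  · simp only [Multiset.sum_cons, Multiset.sum_replicate, nsmul_eq_mul,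
      Nat.cast_pred (show 0 < n by omega), hspike]
    ring
  · simp only [Multiset.sum_cons, Multiset.map_cons, Multiset.map_replicate,
      Multiset.sum_replicate, nsmul_eq_mul, Nat.cast_pred (show 0 < n by omega), hspike, neg_sq,
      div_pow, hr2]
    field_simp
    ring

theorem mainTheorem2 (n k : ℕ) (hn : 2 ≤ n) (hk : 1 ≤ k) :
    (Even n →
      (∀ a ∈ centredSphere n,
        ((n / 2 + k - 1)! : ℝ) / ((k ! : ℝ) * ((n / 2 - 1)! : ℝ) * (n : ℝ) ^ k) ≤ chs (2 * k) a) ∧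
      halfVector n ∈ centredSphere n ∧
      chs (2 * k) (halfVector n) =
        ((n / 2 + k - 1)! : ℝ) / ((k ! : ℝ) * ((n / 2 - 1)! : ℝ) * (n : ℝ) ^ k)) ∧
    (spikeVector n ∈ centredSphere n ∧
      ∀ a ∈ centredSphere n, chs (2 * k) a ≤ chs (2 * k) (spikeVector n)) := by
  refine ⟨fun he => ⟨fun a ha => ?_, halfVector_mem hn he, ?_⟩, spikeVector_mem hn, fun a ha => ?_⟩
  · rw [← balancedCoeff_eq hn he, chs_eq_coeff_chsSeries]
    exact balancedCoeff_le_coeff_chsSeries (map_mem_centredMultisets.2 ha) k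
  · rw [chs_halfVector hn he, balancedCoeff_eq hn he]
  · rw [chs_eq_coeff_chsSeries, chs_eq_coeff_chsSeries, map_spikeVector hn]
    exact coeff_chsSeries_le hn (map_mem_centredMultisets.2 ha) k
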